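/- Let $\mathbb X=(X_n)_{n\ge1}$ be a strictly stationary sequence of real random variables on an arbitrary probability space $(\Omega,\mathcal F,\mathbb P)$, let $a>0$, and let $(k_n)_{n\ge1}$ be integers with $1\le k_n\le n$ for all $n$ and $k_n/n\to1$. Let $X_{1:n}\le\dots\le X_{n:n}$ be the order statistics of $X_1,\dots,X_n$ and put $$K(k_n,n,a)=\sum_{i=1}^n I\big(X_{k_n:n}-a<X_i<X_{k_n:n}\big).$$ Let $\mathcal I^{\mathbb X}$ be the $\sigma$-field of all sets $A\subseteq\Omega$ for which there is a Borel set $B\subseteq\mathbb R^{\mathbb N}$ such that $A=\{\omega:(X_i(\omega),X_{i+1}(\omega),\dots)\in B\}$ for every $i\ge1$. Let $\gamma=\gamma_1(X_1|\mathcal I^{\mathbb X})$ be (any version of) the conditional right endpoint of the support of $X_1$ given $\mathcal I^{\mathbb X}$, that is, an $\mathcal I^{\mathbb X}$-measurable function $\gamma:\Omega\to[-\infty,\infty]$ such that $\mathbb P(X_1\le\gamma\mid\mathcal I^{\mathbb X})=1$ a.s. and such that $\gamma\le Q$ a.s. for every $\mathcal I^{\mathbb X}$-measurable $Q:\Omega\to[-\infty,\infty]$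 with $\mathbb P(X_1\le Q\mid\mathcal I^{\mathbb X})=1$ a.s. Assume that $$\mathbb P(X_1=\gamma)=0\qquad\text{and}\qquad\mathbb P(X_1=\gamma-a)=0 .$$ Then, as $n\to\infty$, $$\frac{K(k_n,n,a)}{n}\longrightarrow\mathbb P\big(X_1>\gamma-a\,\big|\,\mathcal I^{\mathbb X}\big)\qquad\mathbb P\text{-a.s.}$$ -/

import Mathlib

open MeasureTheory ProbabilityTheory Filter Topology

/-- A sequence of random variables (indexed from `0`, so that `X 0` is the first one) is strictly
stationary: every shifted sequence has the same joint law as the sequence itself. -/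
def StrictlyStationary {Ω : Type*} [MeasurableSpace Ω] (μ : Measure Ω) (X : ℕ → Ω → ℝ) : Prop :=
  ∀ m : ℕ, IdentDistrib (fun ω (i : ℕ) => X (m + i) ω) (fun ω (i : ℕ) => X i ω) μ μ

/-- The σ-field of the events that are invariant with respect to the sequence `X`, that is, of the
sets `A` for which there is a Borel set `B` of real sequences such that
`A = {ω | (X i ω, X (i + 1) ω, …) ∈ B}` for every `i`. -/
@[reducible] def invariantSigma {Ω : Type*} (X : ℕ → Ω → ℝ) : MeasurableSpace Ω where
  MeasurableSet' A := ∃ B : Set (ℕ → ℝ), MeasurableSet B ∧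
    ∀ i : ℕ, A = {ω | (fun j : ℕ => X (i + j) ω) ∈ B}
  measurableSet_empty := ⟨∅, MeasurableSet.empty, fun _ => by simp⟩
  measurableSet_compl := by
    rintro A ⟨B, hB, h⟩
    exact ⟨Bᶜ, hB.compl, fun i => by rw [h i]; rfl⟩
  measurableSet_iUnion := by
    intro f hf
    choose B hB h using hf
    refine ⟨⋃ n, B n, MeasurableSet.iUnion hB, fun i => ?_⟩
    ext ω
    simp only [Set.mem_iUnion, Set.mem_ofPred_eq]
    exact exists_congr fun n => by rw [h n i]; rfl

/-- `γ` is (a version of) the conditional right endpoint of the support of `Y` given the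
σ-field `𝒢`: the a.s. smallest `𝒢`-measurable extended random variable that is a.s. at
least `Y`, given `𝒢`. -/
structure IsCondRightEndpoint {Ω : Type*} [mΩ : MeasurableSpace Ω] (μ : Measure Ω) (Y : Ω → ℝ)
    (𝒢 : MeasurableSpace Ω) (γ : Ω → EReal) : Prop where
  measurable : Measurable[𝒢] γ
  le_endpoint : μ⟦{ω | (Y ω : EReal) ≤ γ ω} | 𝒢⟧ =ᵐ[μ] fun _ => (1 : ℝ)
  minimal : ∀ Q : Ω → EReal, Measurable[𝒢] Q →
    μ⟦{ω | (Y ω : EReal) ≤ Q ω} | 𝒢⟧ =ᵐ[μ] (fun _ => (1 : ℝ)) → γ ≤ᵐ[μ] Q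

/-- The `k`-th smallest (`1 ≤ k ≤ n`) of the numbers `x 0, …, x (n - 1)`, counted with
multiplicity. -/
noncomputable def orderStat (x : ℕ → ℝ) (k n : ℕ) : ℝ :=
  if h : 1 ≤ k ∧ k ≤ n then
    (fun i : Fin n => x i) (Tuple.sort (fun i : Fin n => x i) ⟨k - 1, by omega⟩)
  else 0

open scoped Classical in
/-- The number of those among `x 0, …, x (n - 1)` that lie strictly within distance `a` to the left
of their `k`-th order statistic. -/
noncomputable def nearCount (x : ℕ → ℝ) (k n : ℕ) (a : ℝ) : ℕ :=
  ((Finset.range n).filter fun i => orderStat x k n - a < x i ∧ x i < orderStat x k n).card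

theorem invariantSigma_le {Ω : Type*} [mΩ : MeasurableSpace Ω] (X : ℕ → Ω → ℝ)
    (hX : ∀ i, Measurable (X i)) : invariantSigma X ≤ mΩ := by
  rintro A ⟨B, hB, h⟩
  rw [h 0]
  exact (measurable_pi_lambda _ fun j => hX (0 + j)) hB

theorem condProb_eq_one_iff {Ω : Type*} [mΩ : MeasurableSpace Ω] (μ : Measure Ω)
    [IsProbabilityMeasure μ] (𝒢 : MeasurableSpace Ω) (h𝒢 : 𝒢 ≤ mΩ) (s : Set Ω)
    (hs : MeasurableSet[mΩ] s) :
    (μ⟦s | 𝒢⟧ =ᵐ[μ] fun _ => (1 : ℝ)) ↔ ∀ᵐ ω ∂μ, ω ∈ s := by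
  constructor
  · intro h
    have h1 : ∫ ω, (μ⟦s | 𝒢⟧) ω ∂μ = ∫ ω, s.indicator (fun _ => (1 : ℝ)) ω ∂μ :=
      integral_condExp h𝒢
    rw [integral_congr_ae h, integral_indicator hs] at h1
    simp at h1
    have h2 : μ s = 1 := by
      rw [measureReal_def] at h1
      rw [← ENNReal.ofReal_toReal (measure_ne_top μ s), ← h1]; simp
    exact (prob_compl_eq_zero_iff hs).2 h2
  · intro h
    have : s.indicator (fun _ => (1 : ℝ)) =ᵐ[μ] fun _ => 1 := by
      filter_upwards [h] with ω hω
      simp [hω]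
    refine (condExp_congr_ae this).trans ?_
    rw [condExp_const h𝒢]

/-- Every random variable has a conditional right endpoint given every sub-σ-field. -/
theorem exists_isCondRightEndpoint {Ω : Type*} (𝒢 : MeasurableSpace Ω) [mΩ : MeasurableSpace Ω]
    (μ : Measure Ω) [IsProbabilityMeasure μ] (Y : Ω → ℝ) (hY : Measurable[mΩ] Y)
    (h𝒢 : 𝒢 ≤ mΩ) : ∃ γ : Ω → EReal, IsCondRightEndpoint μ Y 𝒢 γ := by
  have hS : ∀ q : ℚ, MeasurableSet[mΩ] {ω | Y ω ≤ q} := fun q => hY measurableSet_Iic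
  let G : ℚ → Set Ω := fun q => {ω | (μ⟦{ω | Y ω ≤ q} | 𝒢⟧) ω = 1}
  have hG : ∀ q, MeasurableSet[𝒢] (G q) := fun q =>
    (stronglyMeasurable_condExp.measurable : Measurable[𝒢] _) (measurableSet_singleton 1)
  classical
  let γ : Ω → EReal := fun ω => ⨅ q : ℚ, if ω ∈ G q then ((q : ℝ) : EReal) else ⊤
  have hmeas (Q : Ω → EReal) (hQ : Measurable[𝒢] Q) :
      MeasurableSet[mΩ] {ω | (Y ω : EReal) ≤ Q ω} :=
    measurableSet_le (measurable_coe_real_ereal.comp hY) (hQ.mono h𝒢 le_rfl)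
  have hγ : Measurable[𝒢] γ := by
    refine Measurable.iInf fun q => ?_
    exact Measurable.ite (hG q) measurable_const measurable_const
  refine ⟨γ, hγ, ?_, ?_⟩
  · rw [condProb_eq_one_iff μ 𝒢 h𝒢 _ (hmeas γ hγ)]
    have : ∀ q : ℚ, ∀ᵐ ω ∂μ, ω ∈ G q → Y ω ≤ q := by
      intro q
      have h1 : ∫ ω in G q, (μ⟦{ω | Y ω ≤ q} | 𝒢⟧) ω ∂μ
          = ∫ ω in G q, ({ω | Y ω ≤ q}.indicator (fun _ => (1 : ℝ))) ω ∂μ :=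
        setIntegral_condExp h𝒢 ((integrable_const 1).indicator (hS q)) (hG q)
      rw [setIntegral_congr_fun (g := fun _ => (1 : ℝ)) (h𝒢 _ (hG q)) (fun ω hω => hω),
        setIntegral_indicator (hS q)] at h1
      simp only [integral_const, smul_eq_mul, mul_one, measureReal_restrict_apply_univ] at h1
      have h2 : μ (G q \ {ω | Y ω ≤ q}) = 0 := by
        have h3 := measureReal_inter_add_sdiff (μ := μ) (s := G q) (hS q)
        rw [← measureReal_eq_zero_iff]
        linarith
      rw [ae_iff]
      convert h2 using 2
      ext ω
      simp
    filter_upwards [ae_all_iff.2 this] with ω hω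
    refine le_iInf fun q => ?_
    split_ifs with h
    · exact_mod_cast hω q h
    · exact le_top
  · intro Q hQ h
    rw [condProb_eq_one_iff μ 𝒢 h𝒢 _ (hmeas Q hQ)] at h
    have : ∀ q : ℚ, ∀ᵐ ω ∂μ, Q ω ≤ ((q : ℝ) : EReal) → ω ∈ G q := by
      intro q
      have hA : MeasurableSet[𝒢] {ω | Q ω ≤ ((q : ℝ) : EReal)} := hQ measurableSet_Iic
      have h1 := condExp_indicator (m := 𝒢) (μ := μ)
        ((integrable_const (1 : ℝ)).indicator (hS q)) hA
      have h2 : {ω | Q ω ≤ ((q : ℝ) : EReal)}.indicator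
          ({ω | Y ω ≤ q}.indicator (fun _ => (1 : ℝ))) =ᵐ[μ]
          {ω | Q ω ≤ ((q : ℝ) : EReal)}.indicator (fun _ => (1 : ℝ)) := by
        filter_upwards [h] with ω hω
        by_cases hq : Q ω ≤ ((q : ℝ) : EReal)
        · have : Y ω ≤ q := by exact_mod_cast le_trans hω hq
          simp [hq, this]
        · simp [hq]
      have h3 := condExp_congr_ae (m := 𝒢) h2
      rw [condExp_of_stronglyMeasurable h𝒢 (stronglyMeasurable_const.indicator hA)
        ((integrable_const (1 : ℝ)).indicator (h𝒢 _ hA))] at h3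
      filter_upwards [h1, h3] with ω e1 e3 hq
      rw [e1] at e3
      simpa [G, hq] using e3
    filter_upwards [ae_all_iff.2 this] with ω hω
    refine le_of_forall_gt fun c hc => ?_
    obtain ⟨q, hq1, hq2⟩ := EReal.exists_rat_btwn_of_lt hc
    refine lt_of_le_of_lt (iInf_le _ q) ?_
    rw [if_pos (hω q hq1.le)]
    exact hq2

/-! By the ergodic theorem on path space, for almost every `ω` the empirical frequencies of the
half-lines `(q, ∞)`, `q` rational, converge to their masses under one probability measure `κ ω`, the
regular conditional law of `X 0` given the invariant events. The rest is deterministic, with `ω`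
frozen.

Every `q < γ` is exceeded with positive limiting frequency
(`IsCondRightEndpoint.ae_condProb_ne_zero`), whereas at most `n - k n = o(n)` terms exceed the order
statistic, so the latter eventually passes `q`. It never passes `γ`, because the invariance of `γ`
extends the bound `X 0 ≤ γ` to all `X i`. Hence the order statistic tends to `γ`, and the window is
trapped: it eventually lies inside `(r, ∞)` for suitable `r < γ - a`, and contains `(p, q]` for `p >
γ - a`, `q < γ`. No mass at `γ - a` and none at `γ` let the two bounds meet
(`tendsto_nearCount_div`).

The ergodic theorem itself comes from a maximal-function argument: `f - E[f | invariants] - ε` has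
negative mean on every non-null invariant set, which is incompatible with Birkhoff sums unbounded
above there. -/

section Birkhoff

/-! ### Birkhoff's pointwise ergodic theorem -/

variable {α : Type*} {T : α → α} {h : α → ℝ}

/-- The running maximum `max_{1 ≤ j ≤ n + 1} birkhoffSum T h j` of the Birkhoff sums. -/
noncomputable def birkhoffMax (T : α → α) (h : α → ℝ) : ℕ → α → ℝ
  | 0 => h
  | n + 1 => fun x => h x + max 0 (birkhoffMax T h n (T x))

theorem le_birkhoffMax (n : ℕ) (x : α) : h x ≤ birkhoffMax T h n x := by
  cases n with
  | zero => exact le_rfl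
  | succ n => exact le_add_of_nonneg_right (le_max_left _ _)

theorem birkhoffMax_le_succ (n : ℕ) (x : α) :
    birkhoffMax T h n x ≤ birkhoffMax T h (n + 1) x := by
  induction n generalizing x with
  | zero => exact le_birkhoffMax 1 x
  | succ n ih => exact add_le_add_right (max_le_max le_rfl (ih (T x))) _

theorem monotone_birkhoffMax (x : α) : Monotone fun n => birkhoffMax T h n x :=
  monotone_nat_of_le_succ fun n => birkhoffMax_le_succ n x

theorem birkhoffSum_le_birkhoffMax (n : ℕ) (x : α) :
    birkhoffSum T h (n + 1) x ≤ birkhoffMax T h n x := by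
  induction n generalizing x with
  | zero => simp [birkhoffMax]
  | succ n ih =>
    rw [birkhoffSum_succ']
    exact add_le_add_right ((ih (T x)).trans (le_max_right _ _)) _

/-- The recursion expresses the maxima at `x` through those at `T x`, up to the finite term `h x`
and a truncation at `0`. This makes the divergence set invariant, so conditional expectations can be
integrated over it. -/
theorem tendsto_birkhoffMax_apply_iff (x : α) :
    Tendsto (fun n => birkhoffMax T h n (T x)) atTop atTop ↔
      Tendsto (fun n => birkhoffMax T h n x) atTop atTop := by
  rw [← tendsto_add_atTop_iff_nat (f := fun n => birkhoffMax T h n x) 1]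
  constructor
  · intro H
    exact tendsto_atTop_add_const_left _ _ (tendsto_atTop_mono (fun n => le_max_right _ _) H)
  · intro H
    have H' : Tendsto (fun n => max 0 (birkhoffMax T h n (T x))) atTop atTop := by
      have := tendsto_atTop_add_const_left _ (-h x) H
      simpa [birkhoffMax] using this
    rw [tendsto_atTop] at H' ⊢
    intro b
    -- A threshold of at least `1` excludes the branch where the truncated maximum is `0`.
    filter_upwards [H' (max b 1)] with n hn
    rcases le_max_iff.1 hn with h0 | h1
    · exact absurd (le_trans (le_max_right b 1) h0) (by norm_num)
    · exact le_trans (le_max_left _ _) h1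

variable [MeasurableSpace α] {μ : Measure α}

theorem measurable_birkhoffMax (hT : Measurable T) (hh : Measurable h) (n : ℕ) :
    Measurable (birkhoffMax T h n) := by
  induction n with
  | zero => exact hh
  | succ n ih => exact hh.add (measurable_const.max (ih.comp hT))

theorem integrable_birkhoffMax (hT : MeasurePreserving T μ μ) (hh : Integrable h μ) (n : ℕ) :
    Integrable (birkhoffMax T h n) μ := by
  induction n with
  | zero => exact hh
  | succ n ih => exact hh.add ((integrable_zero _ _ _).sup (hT.integrable_comp_of_integrable ih))

theorem measurableSet_tendsto_birkhoffMax (hT : Measurable T) (hh : Measurable h) :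
    MeasurableSet[MeasurableSpace.invariants T]
      {x | Tendsto (fun n => birkhoffMax T h n x) atTop atTop} :=
  ⟨measurableSet_tendsto _ (measurable_birkhoffMax hT hh),
    Set.ext fun x => tendsto_birkhoffMax_apply_iff x⟩

/-- The integral of `h` over the set where its Birkhoff sums are unbounded above is
nonnegative. -/
theorem setIntegral_tendsto_birkhoffMax_nonneg (hT : MeasurePreserving T μ μ)
    (hm : Measurable h) (hh : Integrable h μ) :
    0 ≤ ∫ x in {x | Tendsto (fun n => birkhoffMax T h n x) atTop atTop}, h x ∂μ := by
  set A := {x | Tendsto (fun n => birkhoffMax T h n x) atTop atTop} with hA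
  obtain ⟨hAm, hAT⟩ := measurableSet_tendsto_birkhoffMax hT.measurable hm
  have hTA : MeasurePreserving T (μ.restrict A) (μ.restrict A) := by
    have := hT.restrict_preimage hAm
    rwa [hAT] at this
  have hF (n : ℕ) : Integrable (birkhoffMax T h n) (μ.restrict A) :=
    (integrable_birkhoffMax hT hh n).restrict
  have hFT (n : ℕ) : Integrable (fun x => birkhoffMax T h n (T x)) (μ.restrict A) :=
    hTA.integrable_comp_of_integrable (hF n)
  -- The difference equals `h + max (-F) 0` with `F = birkhoffMax T h n ∘ T`. On `A` the last term
  -- eventually vanishes, and `F ≥ h ∘ T` gives the dominating function.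
  have key : Tendsto (fun n => ∫ x in A, (birkhoffMax T h (n + 1) x - birkhoffMax T h n (T x)) ∂μ)
      atTop (𝓝 (∫ x in A, h x ∂μ)) := by
    refine tendsto_integral_of_dominated_convergence (fun x => |h x| + |h (T x)|)
      (fun n => ((hF (n + 1)).sub (hFT n)).aestronglyMeasurable)
      (hh.restrict.abs.add (hTA.integrable_comp_of_integrable hh.restrict).abs) ?_ ?_
    · refine fun n => Eventually.of_forall fun x => ?_
      have h1 := le_birkhoffMax (T := T) (h := h) n (T x)
      simp only [birkhoffMax, Real.norm_eq_abs]
      rcases max_cases 0 (birkhoffMax T h n (T x)) with ⟨e, _⟩ | ⟨e, _⟩ <;> rw [e]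
      · rw [abs_le]
        constructor <;>
          linarith [neg_abs_le (h x), le_abs_self (h x), neg_abs_le (h (T x)), abs_nonneg (h (T x))]
      · simp
    · filter_upwards [ae_restrict_mem hAm] with x hx
      refine tendsto_const_nhds.congr' ?_
      filter_upwards [((tendsto_birkhoffMax_apply_iff x).2 hx).eventually_ge_atTop 0] with n hn
      simp [birkhoffMax, max_eq_right hn]
  refine ge_of_tendsto' key fun n => ?_
  -- Since `T` preserves the restricted measure, composition with `T` can be dropped; the integrals
  -- in `key` become those of increments of a monotone sequence.
  have e : ∫ x in A, birkhoffMax T h n (T x) ∂μ = ∫ x in A, birkhoffMax T h n x ∂μ := by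
    have := integral_map (μ := μ.restrict A) hTA.aemeasurable
      (f := birkhoffMax T h n) (by rw [hTA.map_eq]; exact (hF n).aestronglyMeasurable)
    rw [hTA.map_eq] at this
    exact this.symm
  rw [integral_sub (hF (n + 1)) (hFT n), e, sub_nonneg]
  exact integral_mono (hF n) (hF (n + 1)) fun x => birkhoffMax_le_succ n x

/-- Birkhoff averages are eventually below the conditional expectation given the invariant sets,
up to an arbitrarily small error. -/
theorem ae_eventually_birkhoffAverage_le [IsFiniteMeasure μ] (hT : MeasurePreserving T μ μ)
    {f : α → ℝ} (hfm : Measurable f) (hf : Integrable f μ) {ε : ℝ} (hε : 0 < ε) :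
    ∀ᵐ x ∂μ, ∀ᶠ n : ℕ in atTop,
      birkhoffAverage ℝ T f n x ≤ (μ[f | MeasurableSpace.invariants T]) x + 2 * ε := by
  set g := μ[f | MeasurableSpace.invariants T] with hg
  have hle := MeasurableSpace.invariants_le T
  have hgm : Measurable[MeasurableSpace.invariants T] g :=
    stronglyMeasurable_condExp.measurable
  have hgi : Integrable g μ := integrable_condExp
  set h : α → ℝ := f - (g + fun _ => ε) with hh
  have hm : Measurable h := hfm.sub ((hgm.mono hle le_rfl).add measurable_const)
  have hi : Integrable h μ := hf.sub (hgi.add (integrable_const ε))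
  have hAm := measurableSet_tendsto_birkhoffMax hT.measurable hm
  have h0 := setIntegral_tendsto_birkhoffMax_nonneg hT hm hi
  set A := {x | Tendsto (fun n => birkhoffMax T h n x) atTop atTop} with hA
  -- Since `A` is invariant, `f` and `g` have the same integral over it, leaving `-ε * μ A`, which
  -- must be nonnegative.
  have hμA : μ A = 0 := by
    have e : ∫ x in A, h x ∂μ = -(μ.real A * ε) := by
      have h1 : ∫ x in A, h x ∂μ
          = ∫ x in A, f x ∂μ - (∫ x in A, g x ∂μ + ∫ x in A, ε ∂μ) := by
        rw [← integral_add hgi.restrict (integrable_const ε).restrict]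
        exact integral_sub hf.restrict (hgi.add (integrable_const ε)).restrict
      rw [h1, hg, setIntegral_condExp hle hf hAm]
      simp
    rw [e] at h0
    rw [← measureReal_eq_zero_iff]
    nlinarith [measureReal_nonneg (μ := μ) (s := A)]
  filter_upwards [measure_eq_zero_iff_ae_notMem.1 hμA] with x hx
  obtain ⟨M, hM⟩ : ∃ M, ∀ n, birkhoffMax T h n x ≤ M := by
    rcases tendsto_atTop_of_monotone (monotone_birkhoffMax (T := T) (h := h) x) with H | ⟨l, hl⟩
    · exact absurd H hx
    · exact ⟨l, (monotone_birkhoffMax x).ge_of_tendsto hl⟩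
  -- One `ε` is built into `h`; the other absorbs `M / n` for large `n`.
  obtain ⟨N, hN⟩ := exists_nat_gt (M / ε)
  filter_upwards [eventually_ge_atTop (N + 1)] with n hn
  obtain ⟨m, rfl⟩ : ∃ m, n = m + 1 := ⟨n - 1, by omega⟩
  have h1 := (birkhoffSum_le_birkhoffMax (T := T) (h := h) m x).trans (hM m)
  have hinv : (g + fun _ => ε) ∘ T = g + fun _ => ε := by
    have := MeasurableSpace.comp_eq_of_measurable_invariants hgm
    funext y
    simpa using congrFun this y
  rw [hh, birkhoffSum_sub, birkhoffSum_of_comp_eq hinv] at h1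
  have hpos : (0 : ℝ) < ((m + 1 : ℕ) : ℝ) := by positivity
  have h2 : M ≤ ε * ((m + 1 : ℕ) : ℝ) := by
    rw [div_lt_iff₀ hε] at hN
    have : (N : ℝ) ≤ ((m + 1 : ℕ) : ℝ) := by exact_mod_cast (by omega : N ≤ m + 1)
    nlinarith
  rw [birkhoffAverage, smul_eq_mul, inv_mul_le_iff₀ hpos]
  simp only [Pi.smul_apply, Pi.add_apply, nsmul_eq_mul] at h1
  linarith

/-- **Birkhoff's pointwise ergodic theorem**: the Birkhoff averages of an integrable function
converge almost everywhere to its conditional expectation given the invariant sets. -/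
theorem ae_tendsto_birkhoffAverage [IsFiniteMeasure μ] (hT : MeasurePreserving T μ μ)
    {f : α → ℝ} (hfm : Measurable f) (hf : Integrable f μ) :
    ∀ᵐ x ∂μ, Tendsto (fun n : ℕ => birkhoffAverage ℝ T f n x) atTop
      (𝓝 ((μ[f | MeasurableSpace.invariants T]) x)) := by
  have hε (n : ℕ) : (0 : ℝ) < 1 / (n + 1) := Nat.one_div_pos_of_nat
  filter_upwards [ae_all_iff.2 fun n : ℕ => ae_eventually_birkhoffAverage_le hT hfm hf (hε n),
    ae_all_iff.2 fun n : ℕ => ae_eventually_birkhoffAverage_le hT hfm.neg hf.neg (hε n),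
    condExp_neg (μ := μ) f (MeasurableSpace.invariants T)] with x h1 h2 h3
  rw [Metric.tendsto_nhds]
  intro δ hδ
  obtain ⟨n, hn⟩ := exists_nat_one_div_lt (half_pos hδ)
  filter_upwards [h1 n, h2 n] with k hk1 hk2
  rw [h3, birkhoffAverage_neg] at hk2
  simp only [Pi.neg_apply] at hk2
  rw [Real.dist_eq, abs_lt]
  constructor <;> linarith

end Birkhoff

/-! ### Stationary sequences as shifts on path space -/

section Stationary

/-- The left shift on real sequences. -/
def seqShift (x : ℕ → ℝ) : ℕ → ℝ := fun j => x (j + 1)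

theorem measurable_seqShift : Measurable seqShift :=
  measurable_pi_lambda _ fun j => measurable_pi_apply (j + 1)

theorem seqShift_iterate (i : ℕ) (x : ℕ → ℝ) : seqShift^[i] x = fun j => x (i + j) := by
  induction i generalizing x with
  | zero => simp
  | succ i ih =>
    rw [Function.iterate_succ_apply, ih]
    funext j
    simp only [seqShift]
    congr 1
    omega

/-- The invariant events of a sequence are the preimages of the shift-invariant Borel sets. -/
theorem invariantSigma_eq_comap {Ω : Type*} (X : ℕ → Ω → ℝ) :
    invariantSigma X =
      (MeasurableSpace.invariants seqShift).comap fun ω (i : ℕ) => X i ω := by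
  ext A
  rw [MeasurableSpace.measurableSet_comap]
  constructor
  · rintro ⟨B, hB, h⟩
    -- The given `B` need not be shift-invariant off the range of the sequence; the set of paths
    -- visiting `B` infinitely often is, and it has the same preimage `A`.
    refine ⟨{x | ∃ᶠ i in atTop, seqShift^[i] x ∈ B}, ⟨?_, ?_⟩, ?_⟩
    · have : {x | ∃ᶠ i in atTop, seqShift^[i] x ∈ B} = ⋂ n : ℕ, ⋃ i ≥ n, seqShift^[i] ⁻¹' B := by
        ext x
        simp [frequently_atTop]
      rw [this]
      exact MeasurableSet.iInter fun n => MeasurableSet.iUnion fun i => MeasurableSet.iUnion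
        fun _ => (measurable_seqShift.iterate i) hB
    · ext x
      simp only [Set.preimage_ofPred_eq, Set.mem_ofPred_eq, ← Function.iterate_succ_apply]
      constructor <;> intro H <;> rw [frequently_atTop] at *
      · intro n
        obtain ⟨i, hi, hiB⟩ := H n
        exact ⟨i + 1, by omega, hiB⟩
      · intro n
        obtain ⟨i, hi, hiB⟩ := H (n + 1)
        obtain ⟨j, rfl⟩ : ∃ j, i = j + 1 := ⟨i - 1, by omega⟩
        exact ⟨j, by omega, hiB⟩
    · ext ω
      simp only [Set.preimage_ofPred_eq, Set.mem_ofPred_eq, seqShift_iterate]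
      have hω (i : ℕ) : (fun j => X (i + j) ω) ∈ B ↔ ω ∈ A := by
        rw [h i]
        rfl
      simp [hω]
  · rintro ⟨B, ⟨hB, hinv⟩, rfl⟩
    refine ⟨B, hB, fun i => ?_⟩
    have hi : seqShift^[i] ⁻¹' B = B :=
      (MeasurableSpace.le_invariants_iterate seqShift i B ⟨hB, hinv⟩).2
    ext ω
    change (fun j => X j ω) ∈ B ↔ (fun j => X (i + j) ω) ∈ B
    conv_lhs => rw [← hi]
    rw [Set.mem_preimage, seqShift_iterate]

variable {Ω : Type*} [mΩ : MeasurableSpace Ω] {μ : Measure Ω} {X : ℕ → Ω → ℝ}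

/-- The shift carries the path law to the law of the sequence delayed by one, so stationarity at `m
= 1` suffices. -/
theorem StrictlyStationary.measurePreserving_seqShift (hX : ∀ i, Measurable (X i))
    (hstat : StrictlyStationary μ X) :
    MeasurePreserving seqShift (μ.map fun ω (i : ℕ) => X i ω) (μ.map fun ω (i : ℕ) => X i ω) := by
  refine ⟨measurable_seqShift, ?_⟩
  rw [Measure.map_map measurable_seqShift (measurable_pi_lambda _ hX), ← (hstat 1).map_eq]
  congr 1
  funext ω j
  simp [seqShift, add_comm]

/-- Conditional expectations commute with pull-back along a measurable map. -/
theorem condExp_comp_comap {β : Type*} {m : MeasurableSpace β} [mβ : MeasurableSpace β]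
    [IsFiniteMeasure μ] {φ : Ω → β} (hφ : Measurable φ) (hm : m ≤ mβ) {f : β → ℝ}
    (hf : Integrable f (μ.map φ)) :
    (fun ω => ((μ.map φ)[f | m]) (φ ω)) =ᵐ[μ] μ[fun ω => f (φ ω) | m.comap φ] := by
  have hle : m.comap φ ≤ mΩ := (MeasurableSpace.comap_mono hm).trans hφ.comap_le
  have hfφ : Integrable (fun ω => f (φ ω)) μ := hf.comp_measurable hφ
  have hgφ : Integrable (fun ω => ((μ.map φ)[f | m]) (φ ω)) μ :=
    (integrable_condExp (m := m) (μ := μ.map φ) (f := f)).comp_measurable hφ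
  refine ae_eq_condExp_of_forall_setIntegral_eq hle hfφ (fun s _ _ => hgφ.integrableOn) ?_ ?_
  · rintro _ ⟨B, hB, rfl⟩ -
    rw [← setIntegral_map (hm B hB) hf.aestronglyMeasurable hφ.aemeasurable,
      ← setIntegral_map (hm B hB) integrable_condExp.aestronglyMeasurable hφ.aemeasurable,
      setIntegral_condExp hm hf hB]
  · exact (stronglyMeasurable_condExp.comp_measurable
      (comap_measurable φ : Measurable[m.comap φ, m] φ)).aestronglyMeasurable

/-- The ergodic theorem for strictly stationary sequences. -/
theorem StrictlyStationary.ae_tendsto_average [IsFiniteMeasure μ] (hX : ∀ i, Measurable (X i))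
    (hstat : StrictlyStationary μ X) {f : (ℕ → ℝ) → ℝ} (hfm : Measurable f)
    (hf : Integrable (fun ω => f fun j => X j ω) μ) :
    ∀ᵐ ω ∂μ, Tendsto (fun n : ℕ => (∑ i ∈ Finset.range n, f fun j => X (i + j) ω) / n) atTop
      (𝓝 ((μ[fun ω => f fun j => X j ω | invariantSigma X]) ω)) := by
  have hφ : Measurable fun ω (i : ℕ) => X i ω := measurable_pi_lambda _ hX
  have hf' : Integrable f (μ.map fun ω (i : ℕ) => X i ω) :=
    (integrable_map_measure hfm.aestronglyMeasurable hφ.aemeasurable).2 hf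
  have h1 := ae_of_ae_map hφ.aemeasurable
    (ae_tendsto_birkhoffAverage (hstat.measurePreserving_seqShift hX) hfm hf')
  rw [invariantSigma_eq_comap]
  filter_upwards [h1, condExp_comp_comap hφ (MeasurableSpace.invariants_le seqShift) hf']
    with ω h2 h3
  rw [← h3]
  refine h2.congr fun n => ?_
  simp [birkhoffAverage, birkhoffSum, seqShift_iterate, div_eq_inv_mul]

open scoped Classical in
/-- The frequency of visits of a strictly stationary sequence to a Borel set converges to the
conditional probability given the invariant events. -/
theorem StrictlyStationary.ae_tendsto_frequency [IsFiniteMeasure μ] (hX : ∀ i, Measurable (X i))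
    (hstat : StrictlyStationary μ X) {s : Set ℝ} (hs : MeasurableSet s) :
    ∀ᵐ ω ∂μ, Tendsto (fun n : ℕ =>
        (((Finset.range n).filter fun i => X i ω ∈ s).card : ℝ) / n) atTop
      (𝓝 ((μ⟦X 0 ⁻¹' s | invariantSigma X⟧) ω)) := by
  have hfm : Measurable fun x : ℕ → ℝ => s.indicator (fun _ => (1 : ℝ)) (x 0) :=
    (measurable_const.indicator hs).comp (measurable_pi_apply 0)
  have hf : Integrable (fun ω => s.indicator (fun _ => (1 : ℝ)) (X 0 ω)) μ :=
    (integrable_const (1 : ℝ)).indicator (hX 0 hs)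
  filter_upwards [hstat.ae_tendsto_average hX hfm hf] with ω hω
  refine Tendsto.congr (fun n => ?_) hω
  simp [Set.indicator_apply]

/-- An extended random variable that is measurable with respect to the invariant events and almost
surely bounds the first variable of a strictly stationary sequence almost surely bounds all of
them. -/
theorem StrictlyStationary.ae_le_of_invariant (hX : ∀ i, Measurable (X i))
    (hstat : StrictlyStationary μ X) {γ : Ω → EReal} (hγ : Measurable[invariantSigma X] γ)
    (h : ∀ᵐ ω ∂μ, (X 0 ω : EReal) ≤ γ ω) : ∀ᵐ ω ∂μ, ∀ i, (X i ω : EReal) ≤ γ ω := by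
  have hφ : Measurable fun ω (i : ℕ) => X i ω := measurable_pi_lambda _ hX
  rw [invariantSigma_eq_comap] at hγ
  -- The bound factors through a shift-invariant `g` on path space, where shifting `x 0 ≤ g x`
  -- changes only its left side.
  obtain ⟨g, hg, hgγ⟩ := Measurable.exists_eq_measurable_comp
    (mY := MeasurableSpace.invariants seqShift) hγ
  have hgm : Measurable g := hg.mono (MeasurableSpace.invariants_le _) le_rfl
  have hS : MeasurableSet {x : ℕ → ℝ | (x 0 : EReal) ≤ g x} :=
    measurableSet_le (measurable_coe_real_ereal.comp (measurable_pi_apply 0)) hgm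
  have h0 : ∀ᵐ x ∂(μ.map fun ω (i : ℕ) => X i ω), (x 0 : EReal) ≤ g x := by
    rw [ae_map_iff hφ.aemeasurable hS]
    filter_upwards [h] with ω hω
    simpa [hgγ] using hω
  refine ae_all_iff.2 fun i => ?_
  have hi := ((hstat.measurePreserving_seqShift hX).iterate i).quasiMeasurePreserving.ae h0
  filter_upwards [ae_of_ae_map hφ.aemeasurable hi] with ω hω
  have hgi : g ∘ seqShift^[i] = g := MeasurableSpace.comp_eq_of_measurable_invariants
    (hg.mono (MeasurableSpace.le_invariants_iterate _ i) le_rfl)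
  have := congrFun hgi fun j => X j ω
  simp only [Function.comp_apply] at this
  rw [this, seqShift_iterate] at hω
  rw [hgγ]
  exact hω

end Stationary

/-! ### Order statistics and the deterministic squeeze -/

section OrderStatistics

theorem exists_orderStat_eq (x : ℕ → ℝ) {k n : ℕ} (hk : 1 ≤ k) (hkn : k ≤ n) :
    ∃ i, orderStat x k n = x i := by
  rw [orderStat, dif_pos ⟨hk, hkn⟩]
  exact ⟨_, rfl⟩

-- The sorting permutation sends the first `k` positions to `k` distinct indices with values at most
-- `q`.
open scoped Classical in
theorem add_card_lt_le_of_orderStat_le (x : ℕ → ℝ) {k n : ℕ} (hk : 1 ≤ k) (hkn : k ≤ n) {q : ℝ}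
    (h : orderStat x k n ≤ q) :
    k + ((Finset.range n).filter fun i => q < x i).card ≤ n := by
  rw [orderStat, dif_pos ⟨hk, hkn⟩] at h
  set σ := Tuple.sort (fun i : Fin n => x i) with hσ
  have hmono : Monotone ((fun i : Fin n => x i) ∘ σ) := Tuple.monotone_sort _
  have h1 : k ≤ ((Finset.range n).filter fun i => ¬ q < x i).card := by
    -- The default `0` only makes the map total on `ℕ`; it is not used on `range k`, as `k ≤ n`.
    have hinj : Set.InjOn (fun j : ℕ => if hj : j < n then ((σ ⟨j, hj⟩ : Fin n) : ℕ) else 0)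
        (Finset.range k) := by
      intro i hi j hj hij
      simp only [Finset.coe_range, Set.mem_Iio] at hi hj
      simp only [dif_pos (hi.trans_le hkn), dif_pos (hj.trans_le hkn)] at hij
      simpa using σ.injective (Fin.ext hij)
    calc k = (Finset.range k).card := (Finset.card_range k).symm
      _ ≤ _ := Finset.card_le_card_of_injOn _ (fun j hj => ?_) hinj
    simp only [Finset.coe_range, Set.mem_Iio] at hj
    simp only [dif_pos (hj.trans_le hkn), Finset.coe_filter, Finset.mem_range, Set.mem_ofPred_eq,
      not_lt, Fin.is_lt, true_and]
    refine le_trans (hmono (a := ⟨j, hj.trans_le hkn⟩) (b := ⟨k - 1, by omega⟩) ?_) h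
    rw [Fin.le_def]
    simp only
    omega
  have h2 := Finset.card_filter_add_card_filter_not (s := Finset.range n) (fun i => q < x i)
  rw [Finset.card_range] at h2
  omega

variable (P : Measure ℝ) [IsProbabilityMeasure P]

/-- Continuity from above along levels increasing strictly to `c`; the limit set is the closed
half-line, so an atom at `c` counts. -/
theorem exists_rat_lt_measureReal_Ioi_lt {c : EReal} (hc : c ≠ ⊥) {ε : ℝ} (hε : 0 < ε) :
    ∃ r : ℚ, ((r : ℝ) : EReal) < c ∧
      P.real (Set.Ioi (r : ℝ)) < P.real {y : ℝ | c ≤ (y : EReal)} + ε := by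
  obtain ⟨u, hu, huc, hlim⟩ := exists_seq_strictMono_tendsto' (bot_lt_iff_ne_bot.2 hc)
  have hmeas (n : ℕ) : MeasurableSet {y : ℝ | u n < (y : EReal)} :=
    measurableSet_lt measurable_const measurable_coe_real_ereal
  have hInter : ⋂ n, {y : ℝ | u n < (y : EReal)} = {y : ℝ | c ≤ (y : EReal)} := by
    ext y
    simp only [Set.mem_iInter, Set.mem_ofPred_eq]
    exact ⟨fun h => le_of_tendsto' hlim fun n => (h n).le, fun h n => (huc n).2.trans_le h⟩
  have ht : Tendsto (fun n => P.real {y : ℝ | u n < (y : EReal)}) atTop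
      (𝓝 (P.real {y : ℝ | c ≤ (y : EReal)})) := by
    rw [← hInter]
    refine (ENNReal.tendsto_toReal (measure_ne_top _ _)).comp
      (tendsto_measure_iInter_atTop (fun n => (hmeas n).nullMeasurableSet)
        (fun i j hij y hy => (hu.monotone hij).trans_lt hy) ⟨0, measure_ne_top _ _⟩)
  obtain ⟨n, hn⟩ := (ht.eventually_lt_const (lt_add_of_pos_right _ hε)).exists
  obtain ⟨r, hr1, hr2⟩ := EReal.exists_rat_btwn_of_lt (huc n).2
  refine ⟨r, hr2, (measureReal_mono fun y hy => ?_).trans_lt hn⟩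
  exact hr1.trans (EReal.coe_lt_coe_iff.2 hy)

/-- Continuity from below along levels decreasing strictly to `c`; the limit set is the open
half-line. -/
theorem exists_rat_gt_lt_measureReal_Ioi {c : EReal} (hc : c ≠ ⊤) {ε : ℝ} (hε : 0 < ε) :
    ∃ r : ℚ, c < ((r : ℝ) : EReal) ∧
      P.real {y : ℝ | c < (y : EReal)} - ε < P.real (Set.Ioi (r : ℝ)) := by
  obtain ⟨u, hu, huc, hlim⟩ := exists_seq_strictAnti_tendsto' (lt_top_iff_ne_top.2 hc)
  have hUnion : ⋃ n, {y : ℝ | u n < (y : EReal)} = {y : ℝ | c < (y : EReal)} := by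
    ext y
    simp only [Set.mem_iUnion, Set.mem_ofPred_eq]
    exact ⟨fun ⟨n, h⟩ => (huc n).1.trans h, fun h => (hlim.eventually_lt_const h).exists⟩
  have ht : Tendsto (fun n => P.real {y : ℝ | u n < (y : EReal)}) atTop
      (𝓝 (P.real {y : ℝ | c < (y : EReal)})) := by
    rw [← hUnion]
    refine (ENNReal.tendsto_toReal (measure_ne_top _ _)).comp
      (tendsto_measure_iUnion_atTop (fun i j hij y hy => (hu.antitone hij).trans_lt hy))
  obtain ⟨n, hn⟩ := (ht.eventually_const_lt (sub_lt_self _ hε)).exists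
  obtain ⟨r, hr1, hr2⟩ := EReal.exists_rat_btwn_of_lt (hu (Nat.lt_succ_self n))
  refine ⟨r, (huc _).1.trans hr1, hn.trans_le (measureReal_mono fun y hy => ?_)⟩
  exact EReal.coe_lt_coe_iff.1 (hr2.trans hy)

open scoped Classical in
/-- If the terms above `q` have positive asymptotic frequency, then the order statistics of rank
asymptotic to `n` eventually exceed `q`. -/
theorem eventually_lt_orderStat {x : ℕ → ℝ} {k : ℕ → ℕ} (hk : ∀ n, 1 ≤ n → 1 ≤ k n ∧ k n ≤ n)
    (hk_lim : Tendsto (fun n : ℕ => (k n : ℝ) / (n : ℝ)) atTop (𝓝 1)) {q l : ℝ} (hl : 0 < l)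
    (hq : Tendsto (fun n : ℕ => (((Finset.range n).filter fun i => q < x i).card : ℝ) / n)
      atTop (𝓝 l)) :
    ∀ᶠ n in atTop, q < orderStat x (k n) n := by
  have h1 := (hk_lim.add hq).eventually_const_lt (lt_add_of_pos_right 1 hl)
  filter_upwards [h1, eventually_ge_atTop 1] with n hn hn1
  by_contra! hcon
  have h2 := add_card_lt_le_of_orderStat_le x (hk n hn1).1 (hk n hn1).2 hcon
  rw [← add_div, one_lt_div (by exact_mod_cast hn1)] at hn
  have : (k n : ℝ) + ((Finset.range n).filter fun i => q < x i).card ≤ n := by exact_mod_cast h2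
  linarith

open scoped Classical in
/-- If `P` gives the asymptotic frequencies of a sequence bounded by the right endpoint `γ` of the
support of `P`, and neither `γ` nor `γ - a` is an atom of `P`, then the proportion of terms near an
order statistic of rank asymptotic to `n` converges to the mass of `P` above `γ - a`. -/
theorem tendsto_nearCount_div {x : ℕ → ℝ} {k : ℕ → ℕ} (hk : ∀ n, 1 ≤ n → 1 ≤ k n ∧ k n ≤ n)
    (hk_lim : Tendsto (fun n : ℕ => (k n : ℝ) / (n : ℝ)) atTop (𝓝 1)) (a : ℝ) {γ : EReal}
    (hIoi : ∀ q : ℚ, Tendsto (fun n : ℕ =>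
      (((Finset.range n).filter fun i => x i ∈ Set.Ioi (q : ℝ)).card : ℝ) / n) atTop
        (𝓝 (P.real (Set.Ioi (q : ℝ)))))
    (hx : ∀ i, (x i : EReal) ≤ γ)
    (hpos : ∀ q : ℚ, ((q : ℝ) : EReal) < γ → 0 < P.real (Set.Ioi (q : ℝ)))
    (hend : P.real {y : ℝ | γ ≤ (y : EReal)} = 0)
    (hshift : P.real {y : ℝ | (y : EReal) = γ - a} = 0) :
    Tendsto (fun n : ℕ => (nearCount x (k n) n a : ℝ) / (n : ℝ)) atTop
      (𝓝 (P.real {y : ℝ | γ - a < (y : EReal)})) := by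
  have hγbot : γ ≠ ⊥ := fun h => by simpa [h] using hx 0
  have hγabot : γ - a ≠ ⊥ := by
    induction γ <;> simp_all [← EReal.coe_sub]
  have hO (q : ℚ) (hq : ((q : ℝ) : EReal) < γ) : ∀ᶠ n in atTop, (q : ℝ) < orderStat x (k n) n :=
    eventually_lt_orderStat hk hk_lim (hpos q hq) (hIoi q)
  have hge : P.real {y : ℝ | γ - a ≤ (y : EReal)} ≤ P.real {y : ℝ | γ - a < (y : EReal)} := by
    have : {y : ℝ | γ - a ≤ (y : EReal)}
        ⊆ {y : ℝ | γ - a < (y : EReal)} ∪ {y : ℝ | (y : EReal) = γ - a} := fun y hy =>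
      (lt_or_eq_of_le (show γ - a ≤ (y : EReal) from hy)).imp id Eq.symm
    refine (measureReal_mono this).trans ((measureReal_union_le _ _).trans ?_)
    rw [hshift, add_zero]
  rw [Metric.tendsto_nhds]
  intro ε hε
  have hupper : ∀ᶠ n : ℕ in atTop,
      (nearCount x (k n) n a : ℝ) / n < P.real {y : ℝ | γ - a < (y : EReal)} + ε := by
    -- With `r + a < q < γ`, once the order statistic exceeds `q` every counted term exceeds `q - a
    -- > r`.
    obtain ⟨r, hr, hrP⟩ := exists_rat_lt_measureReal_Ioi_lt P hγabot hε
    have hra : ((r + a : ℝ) : EReal) < γ := by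
      rw [EReal.coe_add]
      exact EReal.add_lt_of_lt_sub hr
    obtain ⟨q, hq1, hq2⟩ := EReal.exists_rat_btwn_of_lt hra
    filter_upwards [hO q hq2, (hIoi r).eventually_lt_const 
      (hrP.trans_le (add_le_add_left hge ε))]
      with n hn1 hn2
    refine lt_of_le_of_lt ?_ hn2
    rw [nearCount]
    gcongr with i
    intro hi
    have : (r : ℝ) + a < q := EReal.coe_lt_coe_iff.1 hq1
    simp only [Set.mem_Ioi]
    linarith [hi.1]
  have hlower : ∀ᶠ n : ℕ in atTop,
      P.real {y : ℝ | γ - a < (y : EReal)} - ε < (nearCount x (k n) n a : ℝ) / n := by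
    -- For an infinite endpoint the limit is `0` and the lower bound is trivial.
    by_cases hγtop : γ - a = ⊤
    · refine Eventually.of_forall fun n => ?_
      have h0 : P.real {y : ℝ | γ - a < (y : EReal)} = 0 := by simp [hγtop]
      rw [h0, zero_sub]
      exact lt_of_lt_of_le (neg_neg_of_pos hε) (by positivity)
    -- Terms in `(p, q]` are eventually counted, because the order statistic minus `a` is at most `γ
    -- - a < p`. Passing to `p` costs `ε / 2`; discarding the terms above `q` costs another, as `P`
    -- has no mass on `[γ, ∞)`.
    obtain ⟨p, hp, hpP⟩ := exists_rat_gt_lt_measureReal_Ioi P hγtop (half_pos hε)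
    obtain ⟨q, hq, hqP⟩ := exists_rat_lt_measureReal_Ioi_lt P hγbot (half_pos hε)
    obtain ⟨q', hq1, hq2⟩ := EReal.exists_rat_btwn_of_lt hq
    have hqq : (q : ℝ) < q' := EReal.coe_lt_coe_iff.1 hq1
    have hlim := (hIoi p).sub (hIoi q)
    filter_upwards [hO q' hq2, eventually_ge_atTop 1, hlim.eventually_const_lt
      (show P.real {y : ℝ | γ - a < (y : EReal)} - ε < _ by linarith)] with n hn1 hn2 hn3
    refine hn3.trans_le ?_
    rw [← sub_div]
    refine div_le_div_of_nonneg_right ?_ (Nat.cast_nonneg n)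
    rw [sub_le_iff_le_add, nearCount]
    norm_cast
    refine le_trans (Finset.card_le_card ?_) (Finset.card_union_le _ _)
    intro i hi
    simp only [Finset.mem_union, Finset.mem_filter, Set.mem_Ioi] at hi ⊢
    by_cases hiq : (q : ℝ) < x i
    · exact Or.inr ⟨hi.1, hiq⟩
    refine Or.inl ⟨hi.1, ?_, by linarith⟩
    obtain ⟨j, hj⟩ := exists_orderStat_eq x (hk n hn2).1 (hk n hn2).2
    rw [hj]
    have h1 : ((x j - a : ℝ) : EReal) < ((p : ℝ) : EReal) := by
      rw [EReal.coe_sub]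
      exact (EReal.sub_le_sub (hx j) le_rfl).trans_lt hp
    exact (EReal.coe_lt_coe_iff.1 h1).trans hi.2
  filter_upwards [hupper, hlower] with n h1 h2
  rw [Real.dist_eq, abs_lt]
  constructor <;> linarith

end OrderStatistics

/-! ### Conditional laws and the conditional endpoint -/

section Conditional

variable {Ω : Type*}

/-- A regular conditional distribution of a real random variable given a sub-σ-field, with the
conditional probabilities of events that also depend on the conditioning. -/
theorem exists_condDistrib_sigma (𝒢 : MeasurableSpace Ω) [mΩ : MeasurableSpace Ω] (μ : Measure Ω)
    [IsFiniteMeasure μ] (h𝒢 : 𝒢 ≤ mΩ) {Y : Ω → ℝ} (hY : Measurable Y) :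
    ∃ κ : Ω → Measure ℝ, (∀ ω, IsProbabilityMeasure (κ ω)) ∧
      ∀ S : Set (Ω × ℝ), MeasurableSet[𝒢.prod inferInstance] S →
        μ⟦{ω | (ω, Y ω) ∈ S} | 𝒢⟧ =ᵐ[μ] fun ω => (κ ω).real {y | (ω, y) ∈ S} := by
  have hid : Measurable[mΩ, 𝒢] (id : Ω → Ω) := measurable_id'' h𝒢
  -- Conditioning on `𝒢` is conditioning on the identity map into `Ω` equipped with `𝒢`.
  refine ⟨fun ω => @condDistrib Ω Ω ℝ _ _ _ mΩ 𝒢 Y id μ _ ω, fun ω => ?_, fun S hS => ?_⟩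
  · exact @IsMarkovKernel.isProbabilityMeasure _ _ 𝒢 _ _ (by infer_instance) ω
  · have hSm : MeasurableSet {ω | (ω, Y ω) ∈ S} :=
      (@Measurable.prodMk _ mΩ _ _ 𝒢 _ _ _ hid hY) hS
    have hf : @StronglyMeasurable _ _ _ (𝒢.prod inferInstance)
        (S.indicator fun _ => (1 : ℝ)) :=
      StronglyMeasurable.indicator stronglyMeasurable_const hS
    have h := @condExp_prod_ae_eq_integral_condDistrib Ω Ω ℝ ℝ _ _ _ _ mΩ μ _ id Y 𝒢 _ _ _
      hid hY.aemeasurable hf ((integrable_const (1 : ℝ)).indicator hSm)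
    rw [MeasurableSpace.comap_id] at h
    refine EventuallyEq.trans ?_ (h.trans (Eventually.of_forall fun ω => ?_))
    · rfl
    · have hSω : MeasurableSet {y | (ω, y) ∈ S} :=
        (@Measurable.prodMk _ _ _ _ 𝒢 _ _ _ (@measurable_const _ _ 𝒢 _ ω) measurable_id) hS
      exact integral_indicator_one hSω

theorem condProb_ae_eq_zero (𝒢 : MeasurableSpace Ω) [mΩ : MeasurableSpace Ω] {μ : Measure Ω}
    {s : Set Ω} (hs : μ s = 0) : μ⟦s | 𝒢⟧ =ᵐ[μ] 0 := by
  have h : s.indicator (fun _ => (1 : ℝ)) =ᵐ[μ] 0 := indicator_meas_zero hs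
  exact (condExp_congr_ae h).trans (by rw [condExp_zero])

/-- Below the conditional right endpoint, exceedances have positive conditional probability. -/
theorem IsCondRightEndpoint.ae_condProb_ne_zero {𝒢 : MeasurableSpace Ω} [mΩ : MeasurableSpace Ω]
    {μ : Measure Ω} [IsProbabilityMeasure μ] {Y : Ω → ℝ} (hY : Measurable Y) (h𝒢 : 𝒢 ≤ mΩ)
    {γ : Ω → EReal} (hγ : IsCondRightEndpoint μ Y 𝒢 γ) (q : ℝ) :
    ∀ᵐ ω ∂μ, (q : EReal) < γ ω → (μ⟦Y ⁻¹' Set.Ioi q | 𝒢⟧) ω ≠ 0 := by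
  classical
  set V := μ⟦Y ⁻¹' Set.Ioi q | 𝒢⟧ with hV
  have hs : MeasurableSet[mΩ] (Y ⁻¹' Set.Ioi q) := hY measurableSet_Ioi
  set A := {ω | V ω = 0} with hA
  have hAm : MeasurableSet[𝒢] A :=
    (stronglyMeasurable_condExp.measurable : Measurable[𝒢] V) (measurableSet_singleton 0)
  -- If `A` met `{q < γ}` in positive measure, this `Q` would be an admissible bound below `γ`
  -- there, against minimality.
  set Q : Ω → EReal := fun ω => if ω ∈ A then (q : EReal) else ⊤ with hQ
  have hQm : Measurable[𝒢] Q := Measurable.ite hAm measurable_const measurable_const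
  have hnull : μ (Y ⁻¹' Set.Ioi q ∩ A) = 0 := by
    have h1 : ∫ ω in A, V ω ∂μ = ∫ ω in A, (Y ⁻¹' Set.Ioi q).indicator (fun _ => (1 : ℝ)) ω ∂μ :=
      setIntegral_condExp h𝒢 ((integrable_const 1).indicator hs) hAm
    rw [setIntegral_congr_fun (g := fun _ => (0 : ℝ)) (h𝒢 _ hAm) (fun ω hω => hω),
      integral_indicator hs, Measure.restrict_restrict hs] at h1
    simpa [measureReal_def, ENNReal.toReal_eq_zero_iff, measure_ne_top] using h1.symm
  have hYQ : ∀ᵐ ω ∂μ, (Y ω : EReal) ≤ Q ω := by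
    filter_upwards [measure_eq_zero_iff_ae_notMem.1 hnull] with ω hω
    by_cases hωA : ω ∈ A
    · have : ¬ q < Y ω := fun h => hω ⟨h, hωA⟩
      simpa [hQ, hωA] using this
    · simp [hQ, hωA]
  have hle := hγ.minimal Q hQm ((condProb_eq_one_iff μ 𝒢 h𝒢 _
    (measurableSet_le (measurable_coe_real_ereal.comp hY) (hQm.mono h𝒢 le_rfl))).2 hYQ)
  filter_upwards [hle] with ω hω hq h0
  have hωA : ω ∈ A := h0
  simp only [hQ, if_pos hωA] at hω
  exact absurd hq (not_lt.2 hω)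

end Conditional

/-! ### The limit theorem -/

theorem theorem3p3 {Ω : Type*} [MeasurableSpace Ω] (μ : Measure Ω) [IsProbabilityMeasure μ]
    (X : ℕ → Ω → ℝ) (hX : ∀ i, Measurable (X i)) (hstat : StrictlyStationary μ X)
    (k : ℕ → ℕ) (hk : ∀ n, 1 ≤ n → 1 ≤ k n ∧ k n ≤ n)
    (hk_lim : Tendsto (fun n : ℕ => (k n : ℝ) / (n : ℝ)) atTop (𝓝 1))
    (a : ℝ) (ha : 0 < a)
    (γ : Ω → EReal) (hγ : IsCondRightEndpoint μ (X 0) (invariantSigma X) γ)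
    (h_end : μ {ω | (X 0 ω : EReal) = γ ω} = 0)
    (h_shift : μ {ω | (X 0 ω : EReal) = γ ω - (a : EReal)} = 0) :
    ∀ᵐ ω ∂μ, Tendsto (fun n : ℕ => (nearCount (fun i => X i ω) (k n) n a : ℝ) / (n : ℝ)) atTop
      (𝓝 ((μ⟦{ω' | γ ω' - (a : EReal) < (X 0 ω' : EReal)} | invariantSigma X⟧) ω)) := by
  classical
  have hle := invariantSigma_le X hX
  obtain ⟨κ, hκ, hκS⟩ := exists_condDistrib_sigma (invariantSigma X) μ hle (hX 0)
  have hγm := hγ.measurable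
  have hX0 : Measurable fun ω => (X 0 ω : EReal) := measurable_coe_real_ereal.comp (hX 0)
  have hXγ : ∀ᵐ ω ∂μ, (X 0 ω : EReal) ≤ γ ω :=
    (condProb_eq_one_iff μ _ hle _ (measurableSet_le hX0 (hγm.mono hle le_rfl))).1 hγ.le_endpoint
  have hfst : @Measurable (Ω × ℝ) EReal ((invariantSigma X).prod inferInstance) _
      (fun z => γ z.1) := hγm.comp (@measurable_fst _ _ (invariantSigma X) _)
  have hsub : @Measurable (Ω × ℝ) EReal ((invariantSigma X).prod inferInstance) _
      (fun z => γ z.1 - (a : EReal)) := by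
    have : Measurable fun c : EReal => c - (a : EReal) :=
      Monotone.measurable fun _ _ h => EReal.sub_le_sub h le_rfl
    exact this.comp hfst
  have hsnd : @Measurable (Ω × ℝ) EReal ((invariantSigma X).prod inferInstance) _
      (fun z => (z.2 : EReal)) :=
    measurable_coe_real_ereal.comp (@measurable_snd _ _ (invariantSigma X) _)
  have hIoi (q : ℚ) : μ⟦X 0 ⁻¹' Set.Ioi (q : ℝ) | invariantSigma X⟧ =ᵐ[μ]
      fun ω => (κ ω).real (Set.Ioi (q : ℝ)) :=
    hκS {z | z.2 ∈ Set.Ioi (q : ℝ)} ((@measurable_snd _ _ (invariantSigma X) _) measurableSet_Ioi)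
  have hnull : μ {ω | γ ω ≤ (X 0 ω : EReal)} = 0 := by
    rw [measure_eq_zero_iff_ae_notMem] at h_end ⊢
    filter_upwards [h_end, hXγ] with ω h1 h2 h3
    exact h1 (le_antisymm h2 h3)
  -- Restricting to rational levels keeps the exceptional sets countable in number; afterwards `ω`
  -- is fixed and `κ ω` plays the role of `P`. The events involving `γ` are sections of
  -- product-measurable sets, so `κ ω` sees `γ ω` as a constant.
  filter_upwards [ae_all_iff.2 fun q : ℚ => hstat.ae_tendsto_frequency hX
      (measurableSet_Ioi (a := (q : ℝ))), ae_all_iff.2 hIoi, hstat.ae_le_of_invariant hX hγm hXγ,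
    ae_all_iff.2 fun q : ℚ => hγ.ae_condProb_ne_zero (hX 0) hle q,
    (hκS {z | γ z.1 ≤ (z.2 : EReal)} (measurableSet_le hfst hsnd)).symm.trans
      (condProb_ae_eq_zero _ hnull),
    (hκS {z | (z.2 : EReal) = γ z.1 - (a : EReal)} (measurableSet_eq_fun hsnd hsub)).symm.trans
      (condProb_ae_eq_zero _ h_shift),
    hκS {z | γ z.1 - (a : EReal) < (z.2 : EReal)} (measurableSet_lt hsub hsnd)]
    with ω hfreq hcond hbdd hpos hend hshift hlim
  have := hκ ω
  change (μ⟦{ω' | γ ω' - (a : EReal) < (X 0 ω' : EReal)} | invariantSigma X⟧) ω = _ at hlim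
  rw [hlim]
  refine tendsto_nearCount_div (κ ω) hk hk_lim a (fun q => ?_) hbdd (fun q hq => ?_) hend hshift
  · rw [← hcond q]
    exact hfreq q
  · refine lt_of_le_of_ne measureReal_nonneg (Ne.symm ?_)
    rw [← hcond q]
    exact hpos q hq
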